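/- Let $V$ be a vector space over a field $\mathbb{F}$ with a linearly ordered basis $\mathbb{B}$, and let $p,t\in\mathbb{F}$ be nonzero scalars. Let $\theta_{a,b}=1$ if $a>b$ and $\theta_{a,b}=0$ otherwise, and let $\tau\colon V\otimes V\to V\otimes V$ be the braiding $$\tau(a\otimes b)=(p^{\theta_{a,b}}-1)\,a\otimes b-p^{\theta_{b,a}}\,b\otimes a,\qquad a,b\in\mathbb{B}.$$ Let $\Lambda_p(V)$ be the exterior algebra $\bigwedge V$, with product $\nabla$, endowed with its braided Hopf algebra structure for which the elements of $V$ are primitive and the braiding $\hat\tau$ is induced by $\tau$. That is, $\hat\tau$ restricts to $\tau$ on $V\otimes V$ and satisfies $$\hat\tau(1\otimes y)=y\otimes 1,\qquad \hat\tau(x\otimes 1)=1\otimes x,$$ $$\hat\tau(\nabla\otimes\mathrm{id})=(\mathrm{id}\otimes\nabla)(\hat\tau\otimes\mathrm{id})(\mathrm{id}\otimes\hat\tau),\qquad \hat\tau(\mathrm{id}\otimes\nabla)=(\nabla\otimes\mathrm{id})(\mathrm{id}\otimes\hat\tau)(\hat\tau\otimes\mathrm{id});$$ the coproduct $\Delta$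 satisfies $\Delta 1=1\otimes 1$, $\Delta v=v\otimes 1+1\otimes v$ for $v\in V$, and $\Delta\nabla=(\nabla\otimes\nabla)(\mathrm{id}\otimes\hat\tau\otimes\mathrm{id})(\Delta\otimes\Delta)$; and the antipode $S$ is the convolution inverse of the identity. For a finite subset $E\subseteq\mathbb{B}$ let $f_E\in\bigwedge V$ be the product of the elements of $E$ in increasing order, and let $\phi_t$ be the algebra automorphism of $\bigwedge V$ with $\phi_t(v)=tv$ for $v\in V$, so that $\phi_t f_E=t^{|E|}f_E$. Let $\nabla^{(2)}\colon\Lambda_p(V)^{\otimes 3}\to\Lambda_p(V)$ be the iterated product, put $$\lambda_R=\nabla^{(2)}\big((S\phi_t)\otimes\mathrm{id}\otimes\mathrm{id}\big)(\hat\tau\otimes\mathrm{id})(\mathrm{id}\otimes\Delta)\colon\Lambda_p(V)\otimes\Lambda_p(V)\to\Lambda_p(V),$$ and write $x\triangleleft y=\lambda_R(x\otimes y)$. Then, for all finite subsets $E,F\subseteq\mathbb{B}$, $$f_E\triangleleft f_F=(tp^{|E|};p)_{|F|}\,f_Ef_F,$$ where $(x;p)_n=\prod_{i=0}^{n-1}(1-xp^i)$.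 -/

import Mathlib

open scoped TensorProduct

noncomputable section

namespace DeformedExterior

section Helpers

variable {F V I A : Type*} [Field F] [AddCommGroup V] [Module F V]

/-- Induction on vectors by linear combinations of basis vectors. -/
theorem basis_induction (b : Module.Basis I F V) {C : V → Prop} (mem : ∀ i, C (b i)) (zero : C 0)
    (add : ∀ x y, C x → C y → C (x + y)) (smul : ∀ (c : F) x, C x → C (c • x)) (v : V) : C v := by
  refine Submodule.span_induction (p := fun x _ => C x) ?_ zero (fun x y _ _ => add x y)
    (fun c x _ => smul c x) (b.mem_span v)
  rintro _ ⟨i, rfl⟩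
  exact mem i

/-- Squares of a linear map into an algebra vanish once they do so, and the images anticommute,
on a linearly ordered basis. -/
theorem sq_eq_zero_of_basis [LinearOrder I] [Ring A] [Algebra F A] (b : Module.Basis I F V)
    (f : V →ₗ[F] A) (h0 : ∀ i, f (b i) * f (b i) = 0)
    (h1 : ∀ i j, i < j → f (b i) * f (b j) + f (b j) * f (b i) = 0) (v : V) :
    f v * f v = 0 := by
  have hB : ∀ v w, f v * f w + f w * f v = 0 := by
    intro v w
    have : (LinearMap.mul F A).compl₁₂ f f + ((LinearMap.mul F A).compl₁₂ f f).flip = 0 := by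
      refine b.ext fun i => b.ext fun j => ?_
      rcases lt_trichotomy i j with h | h | h
      · simpa using h1 i j h
      · subst h; simp [h0]
      · simpa [add_comm] using h1 j i h
    simpa using LinearMap.congr_fun₂ this v w
  induction v using basis_induction b with
  | zero => simp
  | add x y hx hy =>
    have := hB x y
    calc f (x + y) * f (x + y) = f x * f x + f y * f y + (f x * f y + f y * f x) := by
          rw [map_add]; noncomm_ring
      _ = 0 := by rw [hx, hy, this]; simp
  | smul c x hx => simp [hx]
  | mem i => exact h0 i

/-- Induction on elements of the exterior algebra by left multiplication with basis vectors. -/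
theorem left_basis_induction (b : Module.Basis I F V) {C : ExteriorAlgebra F V → Prop}
    (one : C 1) (add : ∀ x y, C x → C y → C (x + y)) (smul : ∀ (c : F) x, C x → C (c • x))
    (mul : ∀ i x, C x → C (ExteriorAlgebra.ι F (b i) * x)) (x : ExteriorAlgebra F V) : C x := by
  induction x using CliffordAlgebra.left_induction with
  | algebraMap r => rw [Algebra.algebraMap_eq_smul_one]; exact smul _ _ one
  | add x y hx hy => exact add _ _ hx hy
  | ι_mul x m hx =>
    change C (ExteriorAlgebra.ι F m * x)
    induction m using basis_induction b with
    | zero => simpa using smul 0 _ one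
    | add m m' h h' => rw [map_add, add_mul]; exact add _ _ h h'
    | smul c m h => rw [map_smul, smul_mul_assoc]; exact smul _ _ h
    | mem i => exact mul i x hx

end Helpers

variable {F V I : Type*} [Field F] [AddCommGroup V] [Module F V] [LinearOrder I]

/-- The Heaviside symbol: `1` if `i > j` and `0` otherwise. -/
def theta (i j : I) : ℕ := if j < i then 1 else 0

/-- The Hecke type R-matrix on `V ⊗ V`: for basis vectors `x`, `y` it maps `x ⊗ y` to
`(p ^ θ(x,y) - 1) x ⊗ y - p ^ θ(y,x) y ⊗ x`. -/
def tau (b : Module.Basis I F V) (p : F) : V ⊗[F] V →ₗ[F] V ⊗[F] V :=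
  (b.tensorProduct b).constr F fun ij =>
    (p ^ theta ij.1 ij.2 - 1) • (b ij.1 ⊗ₜ[F] b ij.2) -
      p ^ theta ij.2 ij.1 • (b ij.2 ⊗ₜ[F] b ij.1)

theorem tau_basis (b : Module.Basis I F V) (p : F) (i j : I) :
    tau b p (b i ⊗ₜ[F] b j) =
      (p ^ theta i j - 1) • (b i ⊗ₜ[F] b j) - p ^ theta j i • (b j ⊗ₜ[F] b i) := by
  have := (b.tensorProduct b).constr_basis F (fun ij : I × I =>
    (p ^ theta ij.1 ij.2 - 1) • (b ij.1 ⊗ₜ[F] b ij.2) -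
      p ^ theta ij.2 ij.1 • (b ij.2 ⊗ₜ[F] b ij.1)) (i, j)
  rwa [Module.Basis.tensorProduct_apply] at this

/-- For `w : V`, the endomorphism `z ⊗ v ↦ ∑ z w' ⊗ v'` of `Λ ⊗ V`,
where `τ (v ⊗ w) = ∑ w' ⊗ v'`. -/
def stepRight (b : Module.Basis I F V) (p : F) :
    V →ₗ[F] Module.End F (ExteriorAlgebra F V ⊗[F] V) :=
  (TensorProduct.curry
    ((LinearMap.mul' F (ExteriorAlgebra F V) ∘ₗ
        (ExteriorAlgebra.ι F).lTensor (ExteriorAlgebra F V)).rTensor V ∘ₗ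
      (TensorProduct.assoc F (ExteriorAlgebra F V) V V).symm.toLinearMap ∘ₗ
      (tau b p).lTensor (ExteriorAlgebra F V) ∘ₗ
      (TensorProduct.assoc F (ExteriorAlgebra F V) V V).toLinearMap)).flip

theorem stepRight_basis (b : Module.Basis I F V) (p : F) (i j : I) (z : ExteriorAlgebra F V) :
    stepRight b p (b j) (z ⊗ₜ[F] b i) =
      (p ^ theta i j - 1) • ((z * ExteriorAlgebra.ι F (b i)) ⊗ₜ[F] b j) -
        p ^ theta j i • ((z * ExteriorAlgebra.ι F (b j)) ⊗ₜ[F] b i) := by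
  simp [stepRight, tau_basis, TensorProduct.tmul_sub]

theorem ι_mul_ι_swap (x y : V) :
    ExteriorAlgebra.ι F x * ExteriorAlgebra.ι F y =
      -(ExteriorAlgebra.ι F y * ExteriorAlgebra.ι F x) :=
  eq_neg_of_add_eq_zero_left (ExteriorAlgebra.ι_add_mul_swap x y)

theorem theta_self (i : I) : theta i i = 0 := by simp [theta]

theorem theta_of_lt {i j : I} (h : i < j) : theta i j = 0 := by simp [theta, h.le]

theorem theta_of_gt {i j : I} (h : i < j) : theta j i = 1 := by simp [theta, h]

theorem stepRight_sq (b : Module.Basis I F V) (p : F) (w : V) :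
    stepRight b p w * stepRight b p w = 0 := by
  refine sq_eq_zero_of_basis (A := Module.End F (ExteriorAlgebra F V ⊗[F] V)) b
    (stepRight b p) (fun j => ?_) (fun j k hjk => ?_) w
  · refine TensorProduct.ext (LinearMap.ext fun z => b.ext fun i => ?_)
    have e1 := ι_mul_ι_swap (F := F) (b j) (b i)
    change stepRight b p (b j) (stepRight b p (b j) (z ⊗ₜ[F] b i)) = 0
    simp only [stepRight_basis, map_sub, map_smul, mul_assoc, ExteriorAlgebra.ι_sq_zero, e1,
      mul_neg, TensorProduct.neg_tmul, mul_zero, TensorProduct.zero_tmul]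
    clear e1
    rcases lt_trichotomy i j with h | h | h
    · simp only [theta_of_lt h, theta_of_gt h, theta_self]; module
    · subst h; simp
    · simp only [theta_of_lt h, theta_of_gt h, theta_self]; module
  · refine TensorProduct.ext (LinearMap.ext fun z => b.ext fun i => ?_)
    have e1 := ι_mul_ι_swap (F := F) (b j) (b i)
    have e2 := ι_mul_ι_swap (F := F) (b k) (b i)
    have e3 := ι_mul_ι_swap (F := F) (b k) (b j)
    change stepRight b p (b j) (stepRight b p (b k) (z ⊗ₜ[F] b i)) +
        stepRight b p (b k) (stepRight b p (b j) (z ⊗ₜ[F] b i)) = 0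
    simp only [stepRight_basis, map_sub, map_smul, mul_assoc, e1, e2, e3,
      mul_neg, TensorProduct.neg_tmul]
    clear e1 e2 e3
    simp only [theta_of_lt hjk, theta_of_gt hjk]
    rcases lt_trichotomy i j with h | h | h
    · have h' := h.trans hjk
      simp only [theta_of_lt h, theta_of_gt h, theta_of_lt h', theta_of_gt h']; module
    · subst h
      simp only [theta_of_lt hjk, theta_of_gt hjk, theta_self, ExteriorAlgebra.ι_sq_zero,
        mul_zero, TensorProduct.zero_tmul]
      module
    · rcases lt_trichotomy i k with h' | h' | h'
      · simp only [theta_of_lt h, theta_of_gt h, theta_of_lt h', theta_of_gt h']; module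
      · subst h'
        simp only [theta_of_lt h, theta_of_gt h, theta_self, ExteriorAlgebra.ι_sq_zero,
          mul_zero, TensorProduct.zero_tmul]
        module
      · simp only [theta_of_lt h, theta_of_gt h, theta_of_lt h', theta_of_gt h']; module

/-- The extension of `stepRight` to an antihomomorphism from `Λ` to endomorphisms of `Λ ⊗ V`. -/
def moveRight (b : Module.Basis I F V) (p : F) :
    ExteriorAlgebra F V →ₐ[F] (Module.End F (ExteriorAlgebra F V ⊗[F] V))ᵐᵒᵖ :=
  ExteriorAlgebra.lift F
    ⟨(MulOpposite.opLinearEquiv F).toLinearMap ∘ₗ stepRight b p, fun w => by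
      simp only [LinearMap.coe_comp, LinearEquiv.coe_coe, Function.comp_apply,
        MulOpposite.coe_opLinearEquiv, ← MulOpposite.op_mul, stepRight_sq, MulOpposite.op_zero]⟩

/-- The part `V ⊗ Λ → Λ ⊗ V` of the braiding: `v ⊗ 1 ↦ 1 ⊗ v`, and `v ⊗ (w y)` is obtained by
first moving `v` past `w` by means of `τ` and then past `y`. -/
def vecBraiding (b : Module.Basis I F V) (p : F) :
    V ⊗[F] ExteriorAlgebra F V →ₗ[F] ExteriorAlgebra F V ⊗[F] V :=
  TensorProduct.lift
    (((MulOpposite.opLinearEquiv F).symm.toLinearMap ∘ₗ (moveRight b p).toLinearMap).flip ∘ₗ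
      TensorProduct.mk F (ExteriorAlgebra F V) V 1)

/-- For `v : V`, the endomorphism `y ⊗ z ↦ ∑ y' ⊗ v' z` of `Λ ⊗ Λ`,
where `∑ y' ⊗ v'` is the braiding of `v ⊗ y`. -/
def stepLeft (b : Module.Basis I F V) (p : F) :
    V →ₗ[F] Module.End F (ExteriorAlgebra F V ⊗[F] ExteriorAlgebra F V) :=
  TensorProduct.curry
    ((LinearMap.mul' F (ExteriorAlgebra F V) ∘ₗ
        (ExteriorAlgebra.ι F).rTensor (ExteriorAlgebra F V)).lTensor (ExteriorAlgebra F V) ∘ₗ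
      (TensorProduct.assoc F (ExteriorAlgebra F V) V (ExteriorAlgebra F V)).toLinearMap ∘ₗ
      (vecBraiding b p).rTensor (ExteriorAlgebra F V) ∘ₗ
      (TensorProduct.assoc F V (ExteriorAlgebra F V) (ExteriorAlgebra F V)).symm.toLinearMap)

/-- Left multiplication by `x` on the first factor of `Λ ⊗ Λ`. -/
def mulLeftFst (F : Type*) (V : Type*) [Field F] [AddCommGroup V] [Module F V] :
    ExteriorAlgebra F V →ₗ[F] Module.End F (ExteriorAlgebra F V ⊗[F] ExteriorAlgebra F V) :=
  LinearMap.rTensorHom (ExteriorAlgebra F V) ∘ₗ LinearMap.mul F (ExteriorAlgebra F V)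

@[simp]
theorem mulLeftFst_tmul (x y z : ExteriorAlgebra F V) :
    mulLeftFst F V x (y ⊗ₜ[F] z) = (x * y) ⊗ₜ[F] z := by
  simp [mulLeftFst]

theorem moveRight_mul_tmul (b : Module.Basis I F V) (p : F) (x : ExteriorAlgebra F V)
    (u : ExteriorAlgebra F V ⊗[F] V) (y : ExteriorAlgebra F V) :
    (moveRight b p y).unop ((LinearMap.mul F _ x).rTensor V u) =
      (LinearMap.mul F _ x).rTensor V ((moveRight b p y).unop u) := by
  induction y using left_basis_induction b generalizing u with
  | one => simp
  | add y y' h h' => simp [h, h']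
  | smul c y h => simp [h]
  | mul j y h =>
    have hs : stepRight b p (b j) ((LinearMap.mul F _ x).rTensor V u) =
        (LinearMap.mul F _ x).rTensor V (stepRight b p (b j) u) := by
      rw [← LinearMap.comp_apply, ← LinearMap.comp_apply]
      congr 1
      refine TensorProduct.ext (LinearMap.ext fun z => b.ext fun i => ?_)
      simp [stepRight_basis, mul_assoc]
    rw [map_mul, MulOpposite.unop_mul, Module.End.mul_apply, Module.End.mul_apply]
    rw [← h]
    congr 1
    simpa [moveRight] using hs

theorem vecBraiding_one (b : Module.Basis I F V) (p : F) (v : V) :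
    vecBraiding b p (v ⊗ₜ[F] 1) = 1 ⊗ₜ[F] v := by
  simp [vecBraiding]

theorem vecBraiding_basis_mul (b : Module.Basis I F V) (p : F) (i j : I)
    (y : ExteriorAlgebra F V) :
    vecBraiding b p (b i ⊗ₜ[F] (ExteriorAlgebra.ι F (b j) * y)) =
      (p ^ theta i j - 1) • (LinearMap.mul F _ (ExteriorAlgebra.ι F (b i))).rTensor V
          (vecBraiding b p (b j ⊗ₜ[F] y)) -
        p ^ theta j i • (LinearMap.mul F _ (ExteriorAlgebra.ι F (b j))).rTensor V
          (vecBraiding b p (b i ⊗ₜ[F] y)) := by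
  have : (moveRight b p (ExteriorAlgebra.ι F (b j))).unop = stepRight b p (b j) := by
    simp [moveRight]
  simp only [vecBraiding, TensorProduct.lift.tmul, LinearMap.comp_apply, LinearMap.flip_apply,
    TensorProduct.mk_apply, LinearEquiv.coe_coe, AlgHom.toLinearMap_apply, map_mul,
    MulOpposite.coe_opLinearEquiv_symm, MulOpposite.unop_mul, Module.End.mul_apply, this,
    stepRight_basis, map_sub, map_smul, one_mul]
  rw [← moveRight_mul_tmul, ← moveRight_mul_tmul]
  simp

theorem stepLeft_one_tmul (b : Module.Basis I F V) (p : F) (v : V) (z : ExteriorAlgebra F V) :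
    stepLeft b p v (1 ⊗ₜ[F] z) = 1 ⊗ₜ[F] (ExteriorAlgebra.ι F v * z) := by
  simp [stepLeft, vecBraiding_one]

theorem stepLeft_basis_mul (b : Module.Basis I F V) (p : F) (i j : I)
    (u : ExteriorAlgebra F V ⊗[F] ExteriorAlgebra F V) :
    stepLeft b p (b i) (mulLeftFst F V (ExteriorAlgebra.ι F (b j)) u) =
      (p ^ theta i j - 1) • mulLeftFst F V (ExteriorAlgebra.ι F (b i)) (stepLeft b p (b j) u) -
        p ^ theta j i • mulLeftFst F V (ExteriorAlgebra.ι F (b j)) (stepLeft b p (b i) u) := by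
  have aux : ∀ (x : ExteriorAlgebra F V) (z : ExteriorAlgebra F V) (u : ExteriorAlgebra F V ⊗[F] V),
      ((LinearMap.mul' F (ExteriorAlgebra F V) ∘ₗ
        (ExteriorAlgebra.ι F).rTensor (ExteriorAlgebra F V)).lTensor (ExteriorAlgebra F V))
      (TensorProduct.assoc F (ExteriorAlgebra F V) V (ExteriorAlgebra F V)
        ((LinearMap.mul F _ x).rTensor V u ⊗ₜ[F] z)) =
      mulLeftFst F V x (((LinearMap.mul' F (ExteriorAlgebra F V) ∘ₗ
        (ExteriorAlgebra.ι F).rTensor (ExteriorAlgebra F V)).lTensor (ExteriorAlgebra F V))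
      (TensorProduct.assoc F (ExteriorAlgebra F V) V (ExteriorAlgebra F V) (u ⊗ₜ[F] z))) := by
    intro x z u
    induction u with
    | zero => simp
    | add u u' h h' => simp only [map_add, TensorProduct.add_tmul, h, h']
    | tmul y v => simp
  induction u with
  | zero => simp
  | add u u' h h' => simp only [map_add, h, h']; module
  | tmul y z =>
    simp only [stepLeft, mulLeftFst_tmul, TensorProduct.curry_apply, LinearMap.comp_apply,
      LinearEquiv.coe_coe, TensorProduct.assoc_symm_tmul, LinearMap.rTensor_tmul,
      vecBraiding_basis_mul, TensorProduct.sub_tmul, ← TensorProduct.smul_tmul', map_sub, map_smul,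
      aux]

theorem vecBraiding_ι (b : Module.Basis I F V) (p : F) (v w : V) :
    vecBraiding b p (v ⊗ₜ[F] ExteriorAlgebra.ι F w) =
      (ExteriorAlgebra.ι F).rTensor V (tau b p (v ⊗ₜ[F] w)) := by
  have : vecBraiding b p ∘ₗ (ExteriorAlgebra.ι F).lTensor V =
      (ExteriorAlgebra.ι F).rTensor V ∘ₗ tau b p := by
    refine TensorProduct.ext (b.ext fun i => b.ext fun j => ?_)
    have h := vecBraiding_basis_mul b p i j 1
    rw [mul_one] at h
    simp [h, vecBraiding_one, tau_basis]
  simpa using LinearMap.congr_fun this (v ⊗ₜ[F] w)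

theorem stepLeft_tmul_mul (b : Module.Basis I F V) (p : F) (v : V) (z : ExteriorAlgebra F V)
    (u : ExteriorAlgebra F V ⊗[F] ExteriorAlgebra F V) :
    stepLeft b p v ((LinearMap.mulRight F z).lTensor _ u) =
      (LinearMap.mulRight F z).lTensor _ (stepLeft b p v u) := by
  have aux : ∀ (z z' : ExteriorAlgebra F V) (u : ExteriorAlgebra F V ⊗[F] V),
      ((LinearMap.mul' F (ExteriorAlgebra F V) ∘ₗ
        (ExteriorAlgebra.ι F).rTensor (ExteriorAlgebra F V)).lTensor (ExteriorAlgebra F V))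
      (TensorProduct.assoc F (ExteriorAlgebra F V) V (ExteriorAlgebra F V) (u ⊗ₜ[F] (z' * z))) =
      (LinearMap.mulRight F z).lTensor _ (((LinearMap.mul' F (ExteriorAlgebra F V) ∘ₗ
        (ExteriorAlgebra.ι F).rTensor (ExteriorAlgebra F V)).lTensor (ExteriorAlgebra F V))
      (TensorProduct.assoc F (ExteriorAlgebra F V) V (ExteriorAlgebra F V) (u ⊗ₜ[F] z'))) := by
    intro z z' u
    induction u with
    | zero => simp
    | add u u' h h' => simp only [map_add, TensorProduct.add_tmul, h, h']
    | tmul y v => simp [mul_assoc]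
  induction u with
  | zero => simp
  | add u u' h h' => simp only [map_add, h, h']
  | tmul y z' =>
    simp only [stepLeft, TensorProduct.curry_apply, LinearMap.comp_apply, LinearMap.lTensor_tmul,
      LinearMap.mulRight_apply, LinearEquiv.coe_coe, TensorProduct.assoc_symm_tmul,
      LinearMap.rTensor_tmul, aux]

theorem mulLeftFst_mul_apply (x y : ExteriorAlgebra F V)
    (u : ExteriorAlgebra F V ⊗[F] ExteriorAlgebra F V) :
    mulLeftFst F V x (mulLeftFst F V y u) = mulLeftFst F V (x * y) u := by
  induction u with
  | zero => simp
  | add u u' h h' => simp only [map_add, h, h']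
  | tmul y z => simp [mul_assoc]

theorem stepLeft_sq (b : Module.Basis I F V) (p : F) (v : V) :
    stepLeft b p v * stepLeft b p v = 0 := by
  have key : ∀ (y z : ExteriorAlgebra F V),
      (∀ j, stepLeft b p (b j) (stepLeft b p (b j) (y ⊗ₜ[F] z)) = 0) ∧
      ∀ j k, j < k → stepLeft b p (b j) (stepLeft b p (b k) (y ⊗ₜ[F] z)) =
        - stepLeft b p (b k) (stepLeft b p (b j) (y ⊗ₜ[F] z)) := by
    intro y z
    induction y using left_basis_induction b with
    | one =>
      constructor
      · intro j
        simp [stepLeft_one_tmul, ← mul_assoc]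
      · intro j k _
        rw [stepLeft_one_tmul, stepLeft_one_tmul, stepLeft_one_tmul, stepLeft_one_tmul,
          ← mul_assoc, ι_mul_ι_swap, neg_mul, TensorProduct.tmul_neg, mul_assoc]
    | add y y' h h' =>
      constructor
      · intro j
        simp [TensorProduct.add_tmul, h.1 j, h'.1 j]
      · intro j k hjk
        simp only [TensorProduct.add_tmul, map_add, h.2 j k hjk, h'.2 j k hjk]
        abel
    | smul c y h =>
      constructor
      · intro j
        simp [← TensorProduct.smul_tmul', h.1 j]
      · intro j k hjk
        simp [← TensorProduct.smul_tmul', h.2 j k hjk]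
    | mul i y h =>
      obtain ⟨h1, h2⟩ := h
      rw [← mulLeftFst_tmul]
      generalize y ⊗ₜ[F] z = u at h1 h2
      constructor
      · intro j
        simp only [stepLeft_basis_mul, map_sub, map_smul, h1, map_zero]
        rcases lt_trichotomy i j with h | h | h
        · simp only [h2 _ _ h, theta_of_lt h, theta_of_gt h, theta_self, map_neg]; module
        · subst h; simp [theta_self]
        · simp only [h2 _ _ h, theta_of_lt h, theta_of_gt h, theta_self, map_neg]; module
      · intro j k hjk
        simp only [stepLeft_basis_mul, map_sub, map_smul, h2 _ _ hjk, theta_of_lt hjk,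
          theta_of_gt hjk]
        rcases lt_trichotomy i j with h | h | h
        · have h' := h.trans hjk
          simp only [h2 _ _ h, h2 _ _ h', theta_of_lt h, theta_of_gt h, theta_of_lt h',
            theta_of_gt h', map_neg]
          module
        · subst h
          simp only [h1, h2 _ _ hjk, theta_of_lt hjk, theta_of_gt hjk, theta_self, map_neg, map_zero]
          module
        · rcases lt_trichotomy i k with h' | h' | h'
          · simp only [h2 _ _ h, h2 _ _ h', theta_of_lt h, theta_of_gt h, theta_of_lt h',
              theta_of_gt h', map_neg]
            module
          · subst h'
            simp only [h1, h2 _ _ h, theta_of_lt h, theta_of_gt h, theta_self, map_neg, map_zero]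
            module
          · simp only [h2 _ _ h, h2 _ _ h', theta_of_lt h, theta_of_gt h, theta_of_lt h',
              theta_of_gt h', map_neg]
            module
  refine sq_eq_zero_of_basis b (stepLeft b p) (fun j => ?_) (fun j k hjk => ?_) v
  · exact TensorProduct.ext' fun y z => (key y z).1 j
  · refine TensorProduct.ext' fun y z => ?_
    simp [(key y z).2 j k hjk]

/-- The extension of `stepLeft` to a homomorphism from `Λ` to endomorphisms of `Λ ⊗ Λ`. -/
def moveLeft (b : Module.Basis I F V) (p : F) :
    ExteriorAlgebra F V →ₐ[F] Module.End F (ExteriorAlgebra F V ⊗[F] ExteriorAlgebra F V) :=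
  ExteriorAlgebra.lift F ⟨stepLeft b p, stepLeft_sq b p⟩

/-- The braiding `β` of `Λ = ExteriorAlgebra F V` induced from `τ`: `1 ⊗ y ↦ y ⊗ 1`, and
`β ((v x) ⊗ y)` is obtained by first moving `x` past `y` and then `v` past the result.
It is the unique linear map that restricts to `τ` on `V ⊗ V` (`braiding_ι_tmul_ι`) and is compatible
with the unit (`braiding_one_tmul`, `braiding_tmul_one`) and with the product
(`braiding_mul_tmul`, `braiding_tmul_mul`). -/
def braiding (b : Module.Basis I F V) (p : F) :
    ExteriorAlgebra F V ⊗[F] ExteriorAlgebra F V →ₗ[F]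
      ExteriorAlgebra F V ⊗[F] ExteriorAlgebra F V :=
  TensorProduct.lift ((moveLeft b p).toLinearMap.flip ∘ₗ
    (TensorProduct.mk F (ExteriorAlgebra F V) (ExteriorAlgebra F V)).flip 1).flip

theorem braiding_tmul (b : Module.Basis I F V) (p : F) (x y : ExteriorAlgebra F V) :
    braiding b p (x ⊗ₜ[F] y) = moveLeft b p x (y ⊗ₜ[F] 1) := by
  simp [braiding]

theorem moveLeft_ι (b : Module.Basis I F V) (p : F) (v : V) :
    moveLeft b p (ExteriorAlgebra.ι F v) = stepLeft b p v := by
  simp [moveLeft]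

theorem moveLeft_tmul_mul (b : Module.Basis I F V) (p : F) (x z : ExteriorAlgebra F V)
    (u : ExteriorAlgebra F V ⊗[F] ExteriorAlgebra F V) :
    moveLeft b p x ((LinearMap.mulRight F z).lTensor _ u) =
      (LinearMap.mulRight F z).lTensor _ (moveLeft b p x u) := by
  induction x using left_basis_induction b with
  | one => simp
  | add x x' h h' => simp [h, h']
  | smul c x h => simp [h]
  | mul i x h => simp [moveLeft_ι, h, stepLeft_tmul_mul]

theorem moveLeft_tmul (b : Module.Basis I F V) (p : F) (x y z : ExteriorAlgebra F V) :
    moveLeft b p x (y ⊗ₜ[F] z) =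
      (LinearMap.mulRight F z).lTensor _ (braiding b p (x ⊗ₜ[F] y)) := by
  rw [braiding_tmul, ← moveLeft_tmul_mul]
  simp

/-- The braiding restricts to `τ` on `V ⊗ V`. -/
theorem braiding_ι_tmul_ι (b : Module.Basis I F V) (p : F) (v w : V) :
    braiding b p (ExteriorAlgebra.ι F v ⊗ₜ[F] ExteriorAlgebra.ι F w) =
      TensorProduct.map (ExteriorAlgebra.ι F) (ExteriorAlgebra.ι F) (tau b p (v ⊗ₜ[F] w)) := by
  rw [braiding_tmul, moveLeft_ι]
  simp only [stepLeft, TensorProduct.curry_apply, LinearMap.comp_apply, LinearEquiv.coe_coe,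
    TensorProduct.assoc_symm_tmul, LinearMap.rTensor_tmul, vecBraiding_ι]
  generalize tau b p (v ⊗ₜ[F] w) = u
  induction u with
  | zero => simp
  | add u u' h h' => simp only [map_add, TensorProduct.add_tmul, h, h']
  | tmul y z => simp

theorem braiding_one_tmul (b : Module.Basis I F V) (p : F) (y : ExteriorAlgebra F V) :
    braiding b p (1 ⊗ₜ[F] y) = y ⊗ₜ[F] 1 := by
  simp [braiding_tmul]

theorem braiding_tmul_one (b : Module.Basis I F V) (p : F) (x : ExteriorAlgebra F V) :
    braiding b p (x ⊗ₜ[F] 1) = 1 ⊗ₜ[F] x := by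
  rw [braiding_tmul]
  induction x using left_basis_induction b with
  | one => simp
  | add x x' h h' => simp [h, h', TensorProduct.tmul_add]
  | smul c x h => simp [h]
  | mul i x h => simp [h, moveLeft_ι, stepLeft_one_tmul]

/-- `β (∇ ⊗ id) = (id ⊗ ∇) (β ⊗ id) (id ⊗ β)`. -/
theorem braiding_mul_tmul (b : Module.Basis I F V) (p : F) (x x' y : ExteriorAlgebra F V) :
    braiding b p ((x * x') ⊗ₜ[F] y) =
      (LinearMap.mul' F (ExteriorAlgebra F V)).lTensor (ExteriorAlgebra F V)
        (TensorProduct.assoc F _ _ _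
          ((braiding b p).rTensor (ExteriorAlgebra F V)
            ((TensorProduct.assoc F _ _ _).symm (x ⊗ₜ[F] braiding b p (x' ⊗ₜ[F] y))))) := by
  rw [braiding_tmul, map_mul, Module.End.mul_apply, ← braiding_tmul]
  generalize braiding b p (x' ⊗ₜ[F] y) = u
  induction u with
  | zero => simp
  | add u u' h h' => simp only [map_add, TensorProduct.tmul_add, h, h']
  | tmul y' z =>
    rw [moveLeft_tmul]
    simp only [TensorProduct.assoc_symm_tmul, LinearMap.rTensor_tmul]
    generalize braiding b p (x ⊗ₜ[F] y') = u
    induction u with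
    | zero => simp
    | add u u' h h' => simp only [map_add, TensorProduct.add_tmul, h, h']
    | tmul y z => simp

/-- `β (id ⊗ ∇) = (∇ ⊗ id) (id ⊗ β) (β ⊗ id)`. -/
theorem braiding_tmul_mul (b : Module.Basis I F V) (p : F) (x y y' : ExteriorAlgebra F V) :
    braiding b p (x ⊗ₜ[F] (y * y')) =
      (LinearMap.mul' F (ExteriorAlgebra F V)).rTensor (ExteriorAlgebra F V)
        ((TensorProduct.assoc F _ _ _).symm
          ((braiding b p).lTensor (ExteriorAlgebra F V)
            (TensorProduct.assoc F _ _ _ (braiding b p (x ⊗ₜ[F] y) ⊗ₜ[F] y')))) := by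
  let G : ExteriorAlgebra F V ⊗[F] ExteriorAlgebra F V →ₗ[F]
      ExteriorAlgebra F V ⊗[F] ExteriorAlgebra F V :=
    (LinearMap.mul' F (ExteriorAlgebra F V)).rTensor (ExteriorAlgebra F V) ∘ₗ
      (TensorProduct.assoc F _ _ _).symm.toLinearMap ∘ₗ
      (braiding b p).lTensor (ExteriorAlgebra F V) ∘ₗ
      (TensorProduct.assoc F _ _ _).toLinearMap ∘ₗ (TensorProduct.mk F _ _).flip y'
  have hG : ∀ y x, G (y ⊗ₜ[F] x) = mulLeftFst F V y (braiding b p (x ⊗ₜ[F] y')) := by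
    intro y x
    simp only [G, LinearMap.comp_apply, LinearMap.flip_apply, TensorProduct.mk_apply,
      LinearEquiv.coe_coe, TensorProduct.assoc_tmul, LinearMap.lTensor_tmul]
    generalize braiding b p (x ⊗ₜ[F] y') = u
    induction u with
    | zero => simp
    | add u u' h h' => simp only [map_add, TensorProduct.tmul_add, h, h']
    | tmul y z => simp
  have hGl : ∀ y u, G (mulLeftFst F V y u) = mulLeftFst F V y (G u) := by
    intro y u
    induction u with
    | zero => simp
    | add u u' h h' => simp only [map_add, h, h']
    | tmul z x => simp only [mulLeftFst_tmul, hG, mulLeftFst_mul_apply]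
  have hGs : ∀ y x i, stepLeft b p (b i) (G (y ⊗ₜ[F] x)) = G (stepLeft b p (b i) (y ⊗ₜ[F] x)) := by
    intro y x
    induction y using left_basis_induction b with
    | one =>
      intro i
      rw [stepLeft_one_tmul, hG, hG, braiding_tmul, braiding_tmul, map_mul, moveLeft_ι]
      have h1 : ∀ u, mulLeftFst F V 1 u = u := fun u => by
        induction u with
        | zero => simp
        | add u u' h h' => simp only [map_add, h, h']
        | tmul z x => simp
      simp [h1]
    | add y z h h' => intro i; simp only [TensorProduct.add_tmul, map_add, h i, h' i]
    | smul c y h => intro i; simp only [← TensorProduct.smul_tmul', map_smul, h i]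
    | mul j y h =>
      intro i
      rw [← mulLeftFst_tmul, hGl, stepLeft_basis_mul, stepLeft_basis_mul, h, h, map_sub, map_smul,
        map_smul, hGl, hGl]
  have hGs' : ∀ u i, stepLeft b p (b i) (G u) = G (stepLeft b p (b i) u) := by
    intro u i
    induction u with
    | zero => simp
    | add u u' h h' => simp only [map_add, h, h']
    | tmul z x => exact hGs z x i
  change _ = G (braiding b p (x ⊗ₜ[F] y))
  rw [braiding_tmul, braiding_tmul]
  induction x using left_basis_induction b with
  | one => simp [hG, braiding_one_tmul]
  | add x x' h h' => simp only [map_add, LinearMap.add_apply, h, h']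
  | smul c x h => simp only [map_smul, LinearMap.smul_apply, h]
  | mul i x h => simp only [map_mul, Module.End.mul_apply, moveLeft_ι, h, hGs']

/-- The operator of left multiplication by `v ⊗ 1 + 1 ⊗ v` for the braided product on `Λ ⊗ Λ`. -/
def stepComul (b : Module.Basis I F V) (p : F) :
    V →ₗ[F] Module.End F (ExteriorAlgebra F V ⊗[F] ExteriorAlgebra F V) :=
  mulLeftFst F V ∘ₗ ExteriorAlgebra.ι F + stepLeft b p

theorem stepComul_sq (b : Module.Basis I F V) (p : F) (v : V) :
    stepComul b p v * stepComul b p v = 0 := by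
  have hm : ∀ u, mulLeftFst F V 0 u = 0 := by simp
  have hL : ∀ v u, stepLeft b p v (stepLeft b p v u) = 0 := fun v u =>
    LinearMap.congr_fun (stepLeft_sq b p v) u
  have hLs : ∀ v w u, stepLeft b p v (stepLeft b p w u) + stepLeft b p w (stepLeft b p v u) = 0 := by
    intro v w u
    have := hL (v + w) u
    simpa [hL] using this
  refine sq_eq_zero_of_basis b (stepComul b p) (fun j => ?_) (fun j k hjk => ?_) v
  · refine LinearMap.ext fun u => ?_
    simp only [stepComul, Module.End.mul_apply, LinearMap.add_apply, LinearMap.comp_apply, map_add,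
      stepLeft_basis_mul, mulLeftFst_mul_apply, ExteriorAlgebra.ι_sq_zero, hL, theta_self,
      LinearMap.zero_apply, hm]
    module
  · refine LinearMap.ext fun u => ?_
    have e := hLs (b j) (b k) u
    simp only [stepComul, Module.End.mul_apply, LinearMap.add_apply, LinearMap.comp_apply, map_add,
      stepLeft_basis_mul, mulLeftFst_mul_apply, theta_of_lt hjk, theta_of_gt hjk,
      ι_mul_ι_swap (b k) (b j), map_neg, LinearMap.neg_apply, LinearMap.zero_apply]
    linear_combination (norm := module) e

/-- The coproduct of `Λ`: the unital homomorphism (`comul_one`, `comul_mul`) to `Λ ⊗ Λ` with the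
braided product `(∇ ⊗ ∇) (id ⊗ β ⊗ id)` for which the elements of `V` are primitive (`comul_ι`). -/
def comul (b : Module.Basis I F V) (p : F) :
    ExteriorAlgebra F V →ₗ[F] ExteriorAlgebra F V ⊗[F] ExteriorAlgebra F V :=
  (ExteriorAlgebra.lift F ⟨stepComul b p, stepComul_sq b p⟩).toLinearMap.flip (1 ⊗ₜ[F] 1)

theorem comul_one (b : Module.Basis I F V) (p : F) : comul b p 1 = 1 ⊗ₜ[F] 1 := by
  simp [comul]

theorem comul_ι_mul (b : Module.Basis I F V) (p : F) (v : V) (x : ExteriorAlgebra F V) :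
    comul b p (ExteriorAlgebra.ι F v * x) = stepComul b p v (comul b p x) := by
  simp [comul]

/-- The elements of `V` are primitive. -/
theorem comul_ι (b : Module.Basis I F V) (p : F) (v : V) :
    comul b p (ExteriorAlgebra.ι F v) =
      ExteriorAlgebra.ι F v ⊗ₜ[F] 1 + 1 ⊗ₜ[F] ExteriorAlgebra.ι F v := by
  simp [comul, stepComul, stepLeft_one_tmul]

/-- Compatibility of the product and the coproduct:
`Δ ∇ = (∇ ⊗ ∇) (id ⊗ β ⊗ id) (Δ ⊗ Δ)`. -/
theorem comul_mul (b : Module.Basis I F V) (p : F) (x y : ExteriorAlgebra F V) :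
    comul b p (x * y) =
      TensorProduct.map (LinearMap.mul' F (ExteriorAlgebra F V))
          (LinearMap.mul' F (ExteriorAlgebra F V))
        ((TensorProduct.assoc F _ _ _).symm
          (((TensorProduct.assoc F _ _ _).toLinearMap ∘ₗ
              (braiding b p).rTensor (ExteriorAlgebra F V) ∘ₗ
              (TensorProduct.assoc F _ _ _).symm.toLinearMap).lTensor (ExteriorAlgebra F V)
            (TensorProduct.assoc F _ _ _ (comul b p x ⊗ₜ[F] comul b p y)))) := by
  generalize hu : comul b p y = u
  let m : ExteriorAlgebra F V ⊗[F] ExteriorAlgebra F V →ₗ[F]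
      ExteriorAlgebra F V ⊗[F] ExteriorAlgebra F V :=
    TensorProduct.map (LinearMap.mul' F (ExteriorAlgebra F V))
        (LinearMap.mul' F (ExteriorAlgebra F V)) ∘ₗ
      (TensorProduct.assoc F _ _ _).symm.toLinearMap ∘ₗ
      ((TensorProduct.assoc F _ _ _).toLinearMap ∘ₗ
        (braiding b p).rTensor (ExteriorAlgebra F V) ∘ₗ
        (TensorProduct.assoc F _ _ _).symm.toLinearMap).lTensor (ExteriorAlgebra F V) ∘ₗ
      (TensorProduct.assoc F _ _ _).toLinearMap ∘ₗ (TensorProduct.mk F _ _).flip u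
  have hm : ∀ x y, m (x ⊗ₜ[F] y) = mulLeftFst F V x (moveLeft b p y u) := by
    intro x y
    simp only [m, LinearMap.comp_apply, LinearMap.flip_apply, TensorProduct.mk_apply,
      LinearEquiv.coe_coe, TensorProduct.assoc_tmul, LinearMap.lTensor_tmul]
    clear hu m
    induction u with
    | zero => simp
    | add u u' h h' => simp only [map_add, TensorProduct.tmul_add, h, h']
    | tmul x' y' =>
      rw [moveLeft_tmul]
      simp only [TensorProduct.assoc_symm_tmul, LinearMap.rTensor_tmul]
      generalize braiding b p (y ⊗ₜ[F] x') = w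
      induction w with
      | zero => simp
      | add u u' h h' => simp only [map_add, TensorProduct.tmul_add, TensorProduct.add_tmul, h, h']
      | tmul z z' => simp
  have hml : ∀ x w, m (mulLeftFst F V x w) = mulLeftFst F V x (m w) := by
    intro x w
    induction w with
    | zero => simp
    | add u u' h h' => simp only [map_add, h, h']
    | tmul z y => simp only [mulLeftFst_tmul, hm, mulLeftFst_mul_apply]
  have h1 : ∀ u, mulLeftFst F V 1 u = u := fun u => by
    induction u with
    | zero => simp
    | add u u' h h' => simp only [map_add, h, h']
    | tmul z x => simp
  have hms : ∀ x y i, stepLeft b p (b i) (m (x ⊗ₜ[F] y)) = m (stepLeft b p (b i) (x ⊗ₜ[F] y)) := by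
    intro x y
    induction x using left_basis_induction b with
    | one =>
      intro i
      simp only [stepLeft_one_tmul, hm, map_mul, moveLeft_ι, h1, Module.End.mul_apply]
    | add y z h h' => intro i; simp only [TensorProduct.add_tmul, map_add, h i, h' i]
    | smul c y h => intro i; simp only [← TensorProduct.smul_tmul', map_smul, h i]
    | mul j y h =>
      intro i
      rw [← mulLeftFst_tmul, hml, stepLeft_basis_mul, stepLeft_basis_mul, h, h, map_sub, map_smul,
        map_smul, hml, hml]
  have hmc : ∀ w i, stepComul b p (b i) (m w) = m (stepComul b p (b i) w) := by
    intro w i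
    induction w with
    | zero => simp
    | add u u' h h' => simp only [map_add, h, h']
    | tmul z y => simp only [stepComul, LinearMap.add_apply, LinearMap.comp_apply, map_add, hml, hms]
  change _ = m (comul b p x)
  induction x using left_basis_induction b with
  | one => simp [hm, comul_one, hu, h1]
  | add x x' h h' => simp only [add_mul, map_add, h, h']
  | smul c x h => simp only [smul_mul_assoc, map_smul, h]
  | mul i x h => rw [mul_assoc, comul_ι_mul, comul_ι_mul, h, hmc]

/-- The diagonal automorphism of `Λ` that multiplies the elements of `V` by `t`. -/
def diagAut (t : F) : ExteriorAlgebra F V →ₐ[F] ExteriorAlgebra F V :=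
  ExteriorAlgebra.map (t • LinearMap.id)

/-- The operator `x ↦ ∇ β (-v ⊗ x)`. -/
def stepAntipode (b : Module.Basis I F V) (p : F) : V →ₗ[F] Module.End F (ExteriorAlgebra F V) :=
  TensorProduct.curry (-(LinearMap.mul' F (ExteriorAlgebra F V) ∘ₗ braiding b p ∘ₗ
    (ExteriorAlgebra.ι F).rTensor (ExteriorAlgebra F V)))

theorem mul'_mulLeftFst (x : ExteriorAlgebra F V)
    (u : ExteriorAlgebra F V ⊗[F] ExteriorAlgebra F V) :
    LinearMap.mul' F (ExteriorAlgebra F V) (mulLeftFst F V x u) = x * LinearMap.mul' F (ExteriorAlgebra F V) u := by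
  induction u with
  | zero => simp
  | add u u' h h' => simp only [map_add, h, h', mul_add]
  | tmul y z => simp [mul_assoc]

theorem mul'_stepLeft (b : Module.Basis I F V) (p : F) (v : V) (y z : ExteriorAlgebra F V) :
    LinearMap.mul' F (ExteriorAlgebra F V) (stepLeft b p v (y ⊗ₜ[F] z)) =
      ExteriorAlgebra.ι F v * diagAut p y * z := by
  induction v using basis_induction b with
  | zero => simp
  | add v v' h h' => simp [h, h', add_mul]
  | smul c v h => simp [h]
  | mem i =>
    induction y using left_basis_induction b generalizing i with
    | one => simp [stepLeft_one_tmul]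
    | add y y' h h' => simp [TensorProduct.add_tmul, h i, h' i, add_mul, mul_add]
    | smul c y h => simp [← TensorProduct.smul_tmul', h i]
    | mul j y h =>
      rw [← mulLeftFst_tmul, stepLeft_basis_mul]
      simp only [map_sub, map_smul, mul'_mulLeftFst, h]
      have e := ι_mul_ι_swap (F := F) (b j) (b i)
      have hd : diagAut p (ExteriorAlgebra.ι F (b j)) = p • ExteriorAlgebra.ι F (b j) := by
        simp [diagAut]
      simp only [map_mul, hd, ← mul_assoc, e, smul_mul_assoc, mul_smul_comm, neg_mul]
      rcases lt_trichotomy i j with h | h | h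
      · simp only [theta_of_lt h, theta_of_gt h]; module
      · subst h; simp
      · simp only [theta_of_lt h, theta_of_gt h]; module

theorem stepAntipode_apply (b : Module.Basis I F V) (p : F) (v : V) (x : ExteriorAlgebra F V) :
    stepAntipode b p v x = -(ExteriorAlgebra.ι F v * diagAut p x) := by
  simp [stepAntipode, braiding_tmul, moveLeft_ι, mul'_stepLeft]

theorem stepAntipode_sq (b : Module.Basis I F V) (p : F) (v : V) :
    stepAntipode b p v * stepAntipode b p v = 0 := by
  refine LinearMap.ext fun x => ?_
  have hd : diagAut p (ExteriorAlgebra.ι F v) = p • ExteriorAlgebra.ι F v := by simp [diagAut]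
  simp [stepAntipode_apply, hd, ← mul_assoc]

/-- The antipode of `Λ`: `S 1 = 1`, `S v = -v` for `v : V`, and `S (v x) = ∇ β (S v ⊗ S x)`.
It is the convolution inverse of the identity (`antipode_left`, `antipode_right`). -/
def antipode (b : Module.Basis I F V) (p : F) : ExteriorAlgebra F V →ₗ[F] ExteriorAlgebra F V :=
  (ExteriorAlgebra.lift F ⟨stepAntipode b p, stepAntipode_sq b p⟩).toLinearMap.flip 1

theorem antipode_one (b : Module.Basis I F V) (p : F) : antipode b p 1 = 1 := by
  simp [antipode]

theorem antipode_ι_mul (b : Module.Basis I F V) (p : F) (v : V) (x : ExteriorAlgebra F V) :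
    antipode b p (ExteriorAlgebra.ι F v * x) =
      -(ExteriorAlgebra.ι F v * diagAut p (antipode b p x)) := by
  simp [antipode, stepAntipode_apply]

theorem diagAut_ι (t : F) (v : V) :
    diagAut t (ExteriorAlgebra.ι F v) = t • ExteriorAlgebra.ι F v := by
  simp [diagAut]

theorem stepLeft_diagAut (b : Module.Basis I F V) (p t : F) (y z : ExteriorAlgebra F V) (i : I) :
    stepLeft b p (b i) (diagAut t y ⊗ₜ[F] z) =
      (diagAut t).toLinearMap.rTensor _ (stepLeft b p (b i) (y ⊗ₜ[F] z)) := by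
  have aux : ∀ i u, (diagAut t).toLinearMap.rTensor _ (mulLeftFst F V (ExteriorAlgebra.ι F (b i)) u) =
      t • mulLeftFst F V (ExteriorAlgebra.ι F (b i)) ((diagAut t).toLinearMap.rTensor _ u) := by
    intro i u
    induction u with
    | zero => simp
    | add u u' h h' => simp only [map_add, h, h', smul_add]
    | tmul y z => simp [diagAut_ι, TensorProduct.smul_tmul']
  induction y using left_basis_induction b generalizing i with
  | one => simp [stepLeft_one_tmul]
  | add y y' h h' => simp only [TensorProduct.add_tmul, map_add, h i, h' i]
  | smul c y h => simp only [← TensorProduct.smul_tmul', map_smul, h i]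
  | mul j y h =>
    rw [map_mul, diagAut_ι, smul_mul_assoc, ← TensorProduct.smul_tmul', ← mulLeftFst_tmul, map_smul,
      stepLeft_basis_mul, ← mulLeftFst_tmul, stepLeft_basis_mul, h, h, map_sub, map_smul, map_smul,
      aux, aux]
    module

theorem stepLeft_antipode (b : Module.Basis I F V) (p : F) (y z : ExteriorAlgebra F V) (i : I) :
    stepLeft b p (b i) (antipode b p y ⊗ₜ[F] z) =
      (antipode b p).rTensor _ (stepLeft b p (b i) (y ⊗ₜ[F] z)) := by
  have aux : ∀ i u, (antipode b p).rTensor _ (mulLeftFst F V (ExteriorAlgebra.ι F (b i)) u) =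
      -mulLeftFst F V (ExteriorAlgebra.ι F (b i))
        ((diagAut p).toLinearMap.rTensor _ ((antipode b p).rTensor _ u)) := by
    intro i u
    induction u with
    | zero => simp
    | add u u' h h' => simp only [map_add, h, h', neg_add]
    | tmul y z => simp [antipode_ι_mul, TensorProduct.neg_tmul]
  induction y using left_basis_induction b generalizing i with
  | one => simp [stepLeft_one_tmul, antipode_one]
  | add y y' h h' => simp only [TensorProduct.add_tmul, map_add, h i, h' i]
  | smul c y h => simp only [← TensorProduct.smul_tmul', map_smul, h i]
  | mul j y h =>
    rw [antipode_ι_mul, TensorProduct.neg_tmul, ← mulLeftFst_tmul, map_neg, stepLeft_basis_mul,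
      ← mulLeftFst_tmul, stepLeft_basis_mul, map_sub, map_smul, map_smul, aux, aux,
      stepLeft_diagAut, stepLeft_diagAut, h, h]
    module

/-- `∇ (S ⊗ id) Δ = η ε`, where `ε` is the augmentation of the exterior algebra. -/
theorem antipode_left (b : Module.Basis I F V) (p : F) (x : ExteriorAlgebra F V) :
    LinearMap.mul' F (ExteriorAlgebra F V) ((antipode b p).rTensor _ (comul b p x)) =
      algebraMap F _ (ExteriorAlgebra.algebraMapInv x) := by
  have key : ∀ i u, LinearMap.mul' F (ExteriorAlgebra F V)
      ((antipode b p).rTensor _ (stepComul b p (b i) u)) = 0 := by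
    intro i u
    induction u with
    | zero => simp
    | add u u' h h' => simp only [map_add, h, h', add_zero]
    | tmul y z =>
      simp only [stepComul, LinearMap.add_apply, LinearMap.comp_apply, map_add, mulLeftFst_tmul,
        LinearMap.rTensor_tmul, antipode_ι_mul, ← stepLeft_antipode, mul'_stepLeft,
        LinearMap.mul'_apply]
      noncomm_ring
  induction x using left_basis_induction b with
  | one => simp [comul_one, antipode_one]
  | add x x' h h' => simp only [map_add, h, h']
  | smul c x h => simp only [map_smul, h, Algebra.algebraMap_eq_smul_one, smul_assoc]
  | mul i x h => rw [comul_ι_mul, key]; simp [ExteriorAlgebra.algebraMapInv]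

/-- `∇ (id ⊗ S) Δ = η ε`. -/
theorem antipode_right (b : Module.Basis I F V) (p : F) (x : ExteriorAlgebra F V) :
    LinearMap.mul' F (ExteriorAlgebra F V) ((antipode b p).lTensor _ (comul b p x)) =
      algebraMap F _ (ExteriorAlgebra.algebraMapInv x) := by
  have aux : ∀ i y z, LinearMap.mul' F (ExteriorAlgebra F V)
      ((antipode b p).lTensor _ (stepLeft b p (b i) (y ⊗ₜ[F] z))) =
      -(ExteriorAlgebra.ι F (b i) * diagAut p y * diagAut p (antipode b p z)) := by
    have aux2 : ∀ x u, LinearMap.mul' F (ExteriorAlgebra F V)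
        ((antipode b p).lTensor _ (mulLeftFst F V x u)) =
        x * LinearMap.mul' F (ExteriorAlgebra F V) ((antipode b p).lTensor _ u) := by
      intro x u
      induction u with
      | zero => simp
      | add u u' h h' => simp only [map_add, h, h', mul_add]
      | tmul y z => simp [mul_assoc]
    intro i y z
    induction y using left_basis_induction b generalizing i with
    | one => simp [stepLeft_one_tmul, antipode_ι_mul]
    | add y y' h h' => simp only [TensorProduct.add_tmul, map_add, h i, h' i]; noncomm_ring
    | smul c y h => simp only [← TensorProduct.smul_tmul', map_smul, h i]; simp
    | mul j y h =>
      rw [← mulLeftFst_tmul, stepLeft_basis_mul]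
      simp only [map_sub, map_smul, aux2, h]
      have e := ι_mul_ι_swap (F := F) (b j) (b i)
      simp only [map_mul, diagAut_ι, mul_neg, ← mul_assoc, e, smul_mul_assoc, mul_smul_comm, neg_mul]
      rcases lt_trichotomy i j with h | h | h
      · simp only [theta_of_lt h, theta_of_gt h]; module
      · subst h; simp
      · simp only [theta_of_lt h, theta_of_gt h]; module
  have key : ∀ i u, LinearMap.mul' F (ExteriorAlgebra F V)
      ((antipode b p).lTensor _ (stepComul b p (b i) u)) = ExteriorAlgebra.ι F (b i) *
        (LinearMap.mul' F (ExteriorAlgebra F V) ((antipode b p).lTensor _ u) -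
          diagAut p (LinearMap.mul' F (ExteriorAlgebra F V) ((antipode b p).lTensor _ u))) := by
    intro i u
    induction u with
    | zero => simp
    | add u u' h h' => simp only [map_add, h, h']; noncomm_ring
    | tmul y z =>
      simp only [stepComul, LinearMap.add_apply, LinearMap.comp_apply, map_add, mulLeftFst_tmul,
        LinearMap.lTensor_tmul, aux, LinearMap.mul'_apply, map_mul]
      noncomm_ring
  induction x using left_basis_induction b with
  | one => simp [comul_one, antipode_one]
  | add x x' h h' => simp only [map_add, h, h']
  | smul c x h => simp only [map_smul, h, Algebra.algebraMap_eq_smul_one, smul_assoc]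
  | mul i x h => rw [comul_ι_mul, key, h]; simp [ExteriorAlgebra.algebraMapInv]

/-- The right action
`λ_R = ∇⁽²⁾ (S φ_t ⊗ id ⊗ id) (β ⊗ id) (id ⊗ Δ)` of `Λ` on itself. -/
def rightAction (b : Module.Basis I F V) (p t : F) :
    ExteriorAlgebra F V ⊗[F] ExteriorAlgebra F V →ₗ[F] ExteriorAlgebra F V :=
  (LinearMap.mul' F (ExteriorAlgebra F V) ∘ₗ
      (LinearMap.mul' F (ExteriorAlgebra F V)).rTensor (ExteriorAlgebra F V)) ∘ₗ
    ((antipode b p ∘ₗ (diagAut t).toLinearMap).rTensor (ExteriorAlgebra F V)).rTensor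
      (ExteriorAlgebra F V) ∘ₗ
    (braiding b p).rTensor (ExteriorAlgebra F V) ∘ₗ
    (TensorProduct.assoc F (ExteriorAlgebra F V) (ExteriorAlgebra F V)
      (ExteriorAlgebra F V)).symm.toLinearMap ∘ₗ
    (comul b p).lTensor (ExteriorAlgebra F V)

/-- The `q`-Pochhammer symbol `(x; q)_n = ∏_{i < n} (1 - x q ^ i)`. -/
def qPochhammer (x q : F) (n : ℕ) : F := ∏ i ∈ Finset.range n, (1 - x * q ^ i)

end DeformedExterior

end

/-! The action is governed by one recursion on its right argument: for a basis vector `v`, acting by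
`v y` is acting by `y` on `x v - t φ_p(x) v`. If `x` has weight `n`, that is `φ_p x = p ^ n x`, this
element is `(1 - t p ^ n) x v`, again a multiple of an element of weight `n + 1`. Feeding in the
factors of `f_F` from left to right, starting from `f_E` of weight `|E|`, produces the factors `1 -
t p ^ (|E| + i)` for `0 ≤ i < |F|`, whose product is the Pochhammer symbol.

For the recursion, write `T = ∇ (S φ_t ⊗ id)`, so that `x ◁ y = T (moveLeft x (Δ y))`
(`rightAction_tmul`). By the definition of the coproduct, `Δ (v y)` is the sum of `stepLeft v (Δ y)`
and of `Δ y` multiplied by `v` on its first factor. The former contributes `(x v) ◁ y`, since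
`moveLeft` is multiplicative. The latter contributes `-t (φ_p(x) v) ◁ y`: under `T`, even after
moving `x` across, multiplication by `v` on the first factor may be traded for `-t stepLeft v` at
the price of replacing `x` by `φ_p x` (`twistedContraction_moveLeft_mulLeftFst`). -/

open ExteriorAlgebra in
/-- Induction on elements of the exterior algebra by right multiplication with basis vectors. -/
theorem DeformedExterior.right_basis_induction {F V I : Type*} [Field F] [AddCommGroup V]
    [Module F V] (b : Module.Basis I F V) {C : ExteriorAlgebra F V → Prop}
    (one : C 1) (add : ∀ x y, C x → C y → C (x + y)) (smul : ∀ (c : F) x, C x → C (c • x))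
    (mul : ∀ i x, C x → C (x * ι F (b i))) (x : ExteriorAlgebra F V) : C x := by
  induction x using CliffordAlgebra.right_induction with
  | algebraMap r => rw [Algebra.algebraMap_eq_smul_one]; exact smul _ _ one
  | add x y hx hy => exact add _ _ hx hy
  | mul_ι m x hx =>
    change C (x * ι F m)
    induction m using basis_induction b with
    | zero => simpa using smul 0 _ one
    | add m m' h h' => rw [map_add, mul_add]; exact add _ _ h h'
    | smul c m h => rw [map_smul, mul_smul_comm]; exact smul _ _ h
    | mem i => exact mul i x hx

namespace DeformedExterior

/-! ### Weights under the diagonal automorphism, and the Pochhammer recursion. -/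

open ExteriorAlgebra

variable {F V I : Type*} [Field F] [AddCommGroup V] [Module F V]

/-- The first factor is split off rather than the last, because the product on the right of the
action is consumed from its left end while the weight of the element acted on grows. -/
theorem qPochhammer_succ' (x q : F) (n : ℕ) :
    qPochhammer x q (n + 1) = (1 - x) * qPochhammer (x * q) q n := by
  simp only [qPochhammer, Finset.prod_range_succ', pow_zero, mul_one, mul_comm (1 - x), pow_succ',
    mul_assoc]

theorem diagAut_list_prod (b : Module.Basis I F V) (p : F) (l : List I) :
    diagAut p (l.map fun i => ι F (b i)).prod = p ^ l.length • (l.map fun i => ι F (b i)).prod := by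
  induction l with
  | nil => simp
  | cons i l ih => simp [diagAut_ι, ih, smul_smul, pow_succ]

/-! ### The contraction `∇ (S φ_t ⊗ id)` and its exchange rule. -/

variable [LinearOrder I]

/-- The map `∇ (S φ_t ⊗ id)`. -/
noncomputable def twistedContraction (b : Module.Basis I F V) (p t : F) :
    ExteriorAlgebra F V ⊗[F] ExteriorAlgebra F V →ₗ[F] ExteriorAlgebra F V :=
  LinearMap.mul' F (ExteriorAlgebra F V) ∘ₗ
    (antipode b p ∘ₗ (diagAut t).toLinearMap).rTensor (ExteriorAlgebra F V)

theorem twistedContraction_tmul (b : Module.Basis I F V) (p t : F) (y z : ExteriorAlgebra F V) :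
    twistedContraction b p t (y ⊗ₜ[F] z) = antipode b p (diagAut t y) * z := by
  simp [twistedContraction]

/-- By associativity, the part of `x` that has crossed the first tensor factor may be multiplied
into the second factor before contracting, and `moveLeft` does exactly this. In this form `x` acts
through an algebra homomorphism, so it can be treated one factor at a time. -/
theorem rightAction_tmul (b : Module.Basis I F V) (p t : F) (x y : ExteriorAlgebra F V) :
    rightAction b p t (x ⊗ₜ[F] y) = twistedContraction b p t (moveLeft b p x (comul b p y)) := by
  simp only [rightAction, LinearMap.comp_apply, LinearEquiv.coe_coe, LinearMap.lTensor_tmul]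
  generalize comul b p y = u
  induction u with
  | zero => simp
  | add u u' h h' => simp only [TensorProduct.tmul_add, map_add, h, h']
  | tmul y z =>
    rw [moveLeft_tmul]
    simp only [TensorProduct.assoc_symm_tmul, LinearMap.rTensor_tmul]
    generalize braiding b p (x ⊗ₜ[F] y) = w
    induction w with
    | zero => simp
    | add u u' h h' => simp only [TensorProduct.add_tmul, map_add, h, h']
    | tmul y' z' => simp [twistedContraction_tmul, mul_assoc]

/-- The braiding with `b i` is natural with respect to `S` and `φ_t`, so both can be applied to `y`
before `b i` crosses it; multiplying after the crossing then only leaves a `φ_p`. -/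
theorem twistedContraction_stepLeft (b : Module.Basis I F V) (p t : F) (i : I)
    (y z : ExteriorAlgebra F V) :
    twistedContraction b p t (stepLeft b p (b i) (y ⊗ₜ[F] z)) =
      ι F (b i) * diagAut p (antipode b p (diagAut t y)) * z := by
  rw [← mul'_stepLeft b, stepLeft_antipode, stepLeft_diagAut, twistedContraction,
    LinearMap.rTensor_comp]
  rfl

/-- The case `x = 1` of the exchange rule. Both sides reduce to the same product: `φ_t` contributes
the factor `t`, and the antipode recursion `S (v y) = -v φ_p (S y)` supplies the sign and the same
`φ_p` that the braiding creates. -/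
theorem twistedContraction_mulLeftFst (b : Module.Basis I F V) (p t : F) (i : I)
    (u : ExteriorAlgebra F V ⊗[F] ExteriorAlgebra F V) :
    twistedContraction b p t (mulLeftFst F V (ι F (b i)) u) =
      -(t • twistedContraction b p t (stepLeft b p (b i) u)) := by
  induction u with
  | zero => simp
  | add u u' h h' => simp only [map_add, h, h', smul_add, neg_add]
  | tmul y z =>
    rw [twistedContraction_stepLeft, mulLeftFst_tmul, twistedContraction_tmul, map_mul, diagAut_ι,
      smul_mul_assoc, map_smul, antipode_ι_mul]
    simp

/-- Polarization of `stepLeft_sq`. -/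
theorem stepLeft_swap (b : Module.Basis I F V) (p : F) (v w : V)
    (u : ExteriorAlgebra F V ⊗[F] ExteriorAlgebra F V) :
    stepLeft b p v (stepLeft b p w u) = -stepLeft b p w (stepLeft b p v u) := by
  have h (v : V) : stepLeft b p v (stepLeft b p v u) = 0 :=
    LinearMap.congr_fun (stepLeft_sq b p v) u
  have := h (v + w)
  simp only [map_add, LinearMap.add_apply, h, zero_add, add_zero] at this
  exact eq_neg_of_add_eq_zero_right this

/-- The rightmost factor of `x` is the first to meet the multiplication by `b j`, hence the
induction by right multiplication. Commuting the two may interchange their indices and leaves a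
`stepLeft` behind, so `j` and `u` must stay general. -/
theorem twistedContraction_moveLeft_mulLeftFst (b : Module.Basis I F V) (p t : F)
    (x : ExteriorAlgebra F V) (j : I) (u : ExteriorAlgebra F V ⊗[F] ExteriorAlgebra F V) :
    twistedContraction b p t (moveLeft b p x (mulLeftFst F V (ι F (b j)) u)) =
      -(t • twistedContraction b p t (moveLeft b p (diagAut p x) (stepLeft b p (b j) u))) := by
  induction x using right_basis_induction b generalizing j u with
  | one => simp [twistedContraction_mulLeftFst]
  | add x y hx hy => simp only [map_add, LinearMap.add_apply, hx, hy, smul_add, neg_add]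
  | smul c x hx =>
    simp only [map_smul, LinearMap.smul_apply, hx, smul_neg, smul_comm c t]
  | mul i x hx =>
    simp only [map_mul, Module.End.mul_apply, moveLeft_ι, stepLeft_basis_mul, map_sub, map_smul, hx,
      diagAut_ι, LinearMap.smul_apply]
    -- In the common order, the total coefficient is `p ^ θ(i,j) - 1 + p ^ θ(j,i)`. For `i ≠ j` one
    -- power is `p` and the other is `1`, so it equals `p`, the factor by which `φ_p` scales `b i`.
    -- For `i = j` every term contains a vanishing square.
    rw [stepLeft_swap b p (b j) (b i)]
    rcases lt_trichotomy i j with h | rfl | h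
    · simp only [theta_of_lt h, theta_of_gt h, map_neg]; module
    · have : stepLeft b p (b i) (stepLeft b p (b i) u) = 0 :=
        LinearMap.congr_fun (stepLeft_sq b p (b i)) u
      simp [this]
    · simp only [theta_of_lt h, theta_of_gt h, map_neg]; module

/-! ### The recursion for the action and its iteration. -/

theorem rightAction_one (b : Module.Basis I F V) (p t : F) (x : ExteriorAlgebra F V) :
    rightAction b p t (x ⊗ₜ[F] 1) = x := by
  rw [rightAction_tmul, comul_one, ← braiding_tmul, braiding_tmul_one, twistedContraction_tmul]
  simp [antipode_one]

/-- Acting by `v y` amounts to acting by `y` on `x ◁ v = x v - t φ_p(x) v`. -/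
theorem rightAction_ι_mul (b : Module.Basis I F V) (p t : F) (i : I)
    (x y : ExteriorAlgebra F V) :
    rightAction b p t (x ⊗ₜ[F] (ι F (b i) * y)) =
      rightAction b p t ((x * ι F (b i) - t • (diagAut p x * ι F (b i))) ⊗ₜ[F] y) := by
  -- The two summands of `stepComul` give the two terms: the exchange rule handles the first, and in
  -- both the remaining `stepLeft` is absorbed into `moveLeft` as a right factor of `x` or `φ_p x`.
  simp only [rightAction_tmul, comul_ι_mul, stepComul, LinearMap.add_apply, LinearMap.comp_apply,
    map_add, twistedContraction_moveLeft_mulLeftFst, map_sub, map_smul, map_mul, moveLeft_ι,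
    LinearMap.sub_apply, LinearMap.smul_apply, Module.End.mul_apply]
  abel

/-- Only the weight of `x` matters, so the induction lets `x` and `n` vary; neither order nor
distinctness of the factors plays a role. -/
theorem rightAction_list_prod (b : Module.Basis I F V) (p t : F) (l : List I) (n : ℕ)
    (x : ExteriorAlgebra F V) (hx : diagAut p x = p ^ n • x) :
    rightAction b p t (x ⊗ₜ[F] (l.map fun i => ι F (b i)).prod) =
      qPochhammer (t * p ^ n) p l.length • (x * (l.map fun i => ι F (b i)).prod) := by
  induction l generalizing x n with
  | nil => simp [rightAction_one, qPochhammer]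
  | cons i l ih =>
    have hxi : x * ι F (b i) - t • (diagAut p x * ι F (b i)) =
        (1 - t * p ^ n) • (x * ι F (b i)) := by
      rw [hx, smul_mul_assoc]; module
    -- The weight rises by one, which is the shift of the argument by `p` in `qPochhammer_succ'`.
    have hd : diagAut p (x * ι F (b i)) = p ^ (n + 1) • (x * ι F (b i)) := by
      rw [map_mul, hx, diagAut_ι, smul_mul_smul_comm, pow_succ]
    rw [List.map_cons, List.prod_cons, rightAction_ι_mul, hxi, ← TensorProduct.smul_tmul', map_smul,
      ih _ _ hd, List.length_cons, qPochhammer_succ', smul_smul, pow_succ, mul_assoc, mul_assoc]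

theorem exists_basis_eq_list_prod (b : Module.Basis I F V) (E : Finset I) :
    ∃ l : List I, l.length = E.card ∧ b.ExteriorAlgebra E = (l.map fun i => ι F (b i)).prod := by
  -- The witness is the increasing enumeration of `E`; only its length is needed later.
  refine ⟨List.ofFn (Set.powersetCard.ofFinEmbEquiv.symm (Set.powersetCard.prodEquiv.symm E).2),
    List.length_ofFn, ?_⟩
  rw [basis_apply, List.map_ofFn]
  exact ιMulti_apply _

end DeformedExterior

theorem mainTheorem7 {F V I : Type*} [Field F] [AddCommGroup V] [Module F V] [LinearOrder I]
    (b : Module.Basis I F V) (p t : F) (hp : p ≠ 0) (ht : t ≠ 0) (E G : Finset I) :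
    DeformedExterior.rightAction b p t (b.ExteriorAlgebra E ⊗ₜ[F] b.ExteriorAlgebra G) =
      DeformedExterior.qPochhammer (t * p ^ E.card) p G.card •
        (b.ExteriorAlgebra E * b.ExteriorAlgebra G) := by
  obtain ⟨l, hl, hE⟩ := DeformedExterior.exists_basis_eq_list_prod b E
  obtain ⟨m, hm, hG⟩ := DeformedExterior.exists_basis_eq_list_prod b G
  rw [hE, hG, ← hl, ← hm]
  exact DeformedExterior.rightAction_list_prod b p t m _ _
    (DeformedExterior.diagAut_list_prod b p l)
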